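/- Let $A$ be a unital $*$-algebra over $\mathbb{C}$ and let $\psi\colon A\to\mathbb{C}$ be a linear functional with $\psi(1)=1$. A self-adjoint element $x$ is called semicircular of variance $v>0$ with respect to a linear functional $\varphi$ if $\varphi(x^m)=\int t^m\,\frac{1}{2\pi v}\sqrt{4v-t^2}\,\mathbf 1_{[-2\sqrt v,2\sqrt v]}(t)\,dt$ for all $m\ge 0$. A family $(x_i)_{i\in I}$ is called a free semicircular family of variance $v$ if each $x_i$ is semicircular of variance $v$ and the unital subalgebras $A_i$ generated by the single elements $x_i$ are free: $\varphi(a_1\cdots a_n)=0$ whenever $n\ge1$, $a_j\in A_{i_j}$, $\varphi(a_j)=0$ for all $j$, and $i_1\ne i_2\ne\cdots\ne i_n$ (consecutive indices differ). Let $N\ge 1$ and let $\{s(i,j,k): 1\le i\le j\le N,\ k=1,2,\dots\}$ be a free semicircular family of variance $1$ in $(A,\psi)$. For $k=1,2,\dots$ let $X_N(k)$ be the $N\times N$ matrix over $A$ whose $(i,j)$ entry is $\sqrt{1+\delta_{i,j}}\;N^{-1/2}\,s(i,j,k)$ if $i\le j$ and $N^{-1/2}\,s(j,i,k)$ if $i>j$.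 Let $\psi_N=\frac1N\mathrm{Tr}\otimes\psi$ on $M_{N\times N}(A)$, that is, $\psi_N(M)=\frac1N\sum_{i=1}^N\psi(M_{ii})$. Then $\{X_N(k):k=1,2,\dots\}$ is a free semicircular family of variance $1+\frac1N$ in $(M_{N\times N}(A),\psi_N)$; in particular each $X_N(k)$ is self-adjoint and semicircular of variance $1+\frac1N$. Moreover, for each $k$, $\psi_N(X_N(k)^m)=0$ if $m$ is odd, and for every $n\ge0$ $$\psi_N\bigl(X_N(k)^{2n}\bigr)=C_n\Bigl(1+\frac1N\Bigr)^n,$$ where $C_n$ is the number of non-crossing pairings of $\{1,\dots,2n\}$. -/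

import Mathlib

namespace FreeProb

variable {A : Type*} [Ring A] [Algebra ℂ A]

/-- Freeness of a family of unital subalgebras of `A` with respect to a linear functional `φ`:
`φ (a₁ a₂ ⋯ aₙ) = 0` whenever `n ≥ 1`, `aⱼ ∈ B (iⱼ)`, `φ aⱼ = 0` for all `j`, and
`i₁ ≠ i₂ ≠ ⋯ ≠ iₙ` (consecutive indices differ). The list entries are the pairs `(iⱼ, aⱼ)`. -/
def FreeSubalgebras {ι : Type*} (φ : A →ₗ[ℂ] ℂ) (B : ι → Subalgebra ℂ A) : Prop :=
  ∀ l : List (ι × A), l ≠ [] →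
    l.IsChain (fun p q => p.1 ≠ q.1) →
    (∀ p ∈ l, p.2 ∈ B p.1 ∧ φ p.2 = 0) →
    φ (l.map Prod.snd).prod = 0

/-- The centered semicircle law of variance `v > 0`, with density
`√(4v - t²) / (2πv)` on `[-2√v, 2√v]` (the real square root vanishes outside that interval). -/
noncomputable def semicircleLaw (v : ℝ) : MeasureTheory.Measure ℝ :=
  MeasureTheory.volume.withDensity
    (fun t => ENNReal.ofReal (Real.sqrt (4 * v - t ^ 2) / (2 * Real.pi * v)))

/-- `x` is a (centered) semicircular element of variance `v`: it is self-adjoint and its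
moments are those of the semicircle law of variance `v`. -/
def IsSemicircular [StarRing A] (φ : A →ₗ[ℂ] ℂ) (v : ℝ) (x : A) : Prop :=
  IsSelfAdjoint x ∧ ∀ m : ℕ, φ (x ^ m) = ((∫ t, t ^ m ∂(semicircleLaw v) : ℝ) : ℂ)

/-- A free semicircular family of variance `v`: each member is semicircular of variance `v`,
and the unital algebras generated by the single members are free. (The members being
self-adjoint, these are also the unital star-algebras that they generate.) -/
def IsFreeSemicircularFamily [StarRing A] {ι : Type*} (φ : A →ₗ[ℂ] ℂ) (v : ℝ)
    (x : ι → A) : Prop :=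
  (∀ i, IsSemicircular φ v (x i)) ∧
    FreeSubalgebras φ (fun i => Algebra.adjoin ℂ {x i})

/-- The functional `ψ_N = (1/N) Tr ⊗ ψ` on `N × N` matrices over `A`, that is
`ψ_N M = (1/N) ∑ i, ψ (M i i)`. -/
noncomputable def matrixFunctional (N : ℕ) (ψ : A →ₗ[ℂ] ℂ) :
    Matrix (Fin N) (Fin N) A →ₗ[ℂ] ℂ :=
  (N : ℂ)⁻¹ • (ψ ∘ₗ Matrix.traceLinearMap (Fin N) ℂ A)

/-- The matrix `X_N(k)`: its `(i, j)` entry is `√(1 + δ_{ij}) N^{-1/2} s(i, j, k)` for `i ≤ j`,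
and equals the `(j, i)` entry for `i > j`. Only the values `s i j k` with `i ≤ j` are used. -/
noncomputable def semicircularMatrix (N : ℕ) (s : Fin N → Fin N → ℕ+ → A) (k : ℕ+) :
    Matrix (Fin N) (Fin N) A :=
  Matrix.of fun i j =>
    (((Real.sqrt (1 + if i = j then 1 else 0) / Real.sqrt N : ℝ) : ℂ)) • s (min i j) (max i j) k

/-- `f` is a non-crossing pairing of `Fin m`: a pairing is the fixed-point-free involution `f`
that exchanges the two elements of each pair, and no two pairs `{i, f i}` and `{j, f j}` cross. -/
def IsNoncrossingPairing {m : ℕ} (f : Fin m → Fin m) : Prop :=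
  (∀ i, f (f i) = i) ∧ (∀ i, f i ≠ i) ∧ ∀ i j, ¬ (i < j ∧ j < f i ∧ f i < f j)

/-- The number `C_n` of non-crossing pairings of a linearly ordered set with `2n` elements. -/
noncomputable def numNoncrossingPairings (n : ℕ) : ℕ :=
  Nat.card {f : Fin (2 * n) → Fin (2 * n) // IsNoncrossingPairing f}

end FreeProb

/-!
For the semicircle law of variance `v` the orthogonal polynomials are `dickson 2 v n`, the rescaled
Chebyshev polynomials of the second kind. Hence a family of self-adjoint elements is free
semicircular of variance `v` if and only if all of its nonempty Wick words are centered: on a block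
of equal letters the Wick word is such a polynomial, and the Wick word of a concatenation of blocks
is the product over the blocks.

An entry of a Wick word of the matrices is a sum, over paths of matrix indices, of Wick words of
their entries: contracting two adjacent matrices contracts a step `a → c` of the path with the
step `c → a`, and summing the squared coefficients `(1 + δ a c) / N` over `c` gives the factor
`1 + 1 / N` by which the variance grows. So centered Wick words of the entries yield centered Wick
words of the matrices.

The even moments of the semicircle law are Catalan numbers after the substitution `t = 2√v cos θ`,
and the noncrossing pairings satisfy the Catalan recursion according to the partner of the smallest
point.
-/

open MeasureTheory Polynomial

namespace FreeProb

section Dickson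

variable {R : Type*} [CommRing R]

theorem dickson_two_zero (v : R) : dickson 2 v 0 = 1 := by
  norm_num [dickson_zero]

theorem span_range_dickson_two (v : R) : Submodule.span R (Set.range (dickson 2 v)) = ⊤ := by
  set S := Submodule.span R (Set.range (dickson 2 v))
  have dickson_mem (n : ℕ) : dickson 2 v n ∈ S := Submodule.subset_span ⟨n, rfl⟩
  have X_mul_mem (p : R[X]) (hp : p ∈ S) : X * p ∈ S := by
    induction hp using Submodule.span_induction with
    | mem p hp =>
      obtain ⟨n, rfl⟩ := hp
      cases n with
      | zero => simpa only [dickson_two_zero, mul_one, dickson_one] using dickson_mem 1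
      | succ n =>
        have hrec : X * dickson 2 v (n + 1) = dickson 2 v (n + 2) + v • dickson 2 v n := by
          rw [dickson_add_two, smul_eq_C_mul, sub_add_cancel]
        exact hrec ▸ S.add_mem (dickson_mem _) (S.smul_mem v (dickson_mem n))
    | zero => simp
    | add p q _ _ hp hq => exact mul_add X p q ▸ S.add_mem hp hq
    | smul a p _ hp => exact mul_smul_comm a X p ▸ S.smul_mem a hp
  have X_pow_mem (n : ℕ) : (X : R[X]) ^ n ∈ S := by
    induction n with
    | zero => simpa only [dickson_two_zero, pow_zero] using dickson_mem 0
    | succ n ih => exact pow_succ' (X : R[X]) n ▸ X_mul_mem _ ih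
  refine eq_top_iff.2 fun p _ => ?_
  rw [p.as_sum_range_C_mul_X_pow]
  exact S.sum_mem fun n _ => smul_eq_C_mul (p.coeff n) ▸ S.smul_mem _ (X_pow_mem n)

theorem exists_smul_one_add_mem_span_dickson_two (v : R) (p : R[X]) :
    ∃ a : R, ∃ q ∈ Submodule.span R (Set.range fun n => dickson 2 v (n + 1)),
      p = a • 1 + q := by
  have hp : p ∈ Submodule.span R (Set.range (dickson 2 v)) :=
    span_range_dickson_two v ▸ Submodule.mem_top
  rw [← Nat.range_of_succ, Set.singleton_union, Submodule.mem_span_insert] at hp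
  rwa [dickson_two_zero] at hp

theorem eval_dickson_two_mul_sin (r θ : ℝ) (n : ℕ) :
    (dickson 2 (r ^ 2) n).eval (2 * r * Real.cos θ) * Real.sin θ =
      r ^ n * Real.sin ((n + 1 : ℝ) * θ) := by
  induction n using Nat.twoStepInduction with
  | zero => simp only [dickson_two_zero, eval_one, pow_zero, Nat.cast_zero, zero_add, one_mul]
  | one =>
    rw [dickson_one, eval_X, Nat.cast_one, one_add_one_eq_two, Real.sin_two_mul]
    ring
  | more n ih₀ ih₁ =>
    have hadd : Real.sin ((n + 2 + 1 : ℝ) * θ) + Real.sin ((n + 1 : ℝ) * θ) =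
        2 * Real.cos θ * Real.sin ((n + 1 + 1 : ℝ) * θ) := by
      rw [show (n + 2 + 1 : ℝ) * θ = (n + 1 + 1 : ℝ) * θ + θ by ring,
        show (n + 1 : ℝ) * θ = (n + 1 + 1 : ℝ) * θ - θ by ring, Real.sin_add, Real.sin_sub]
      ring
    push_cast at ih₁ ⊢
    rw [dickson_add_two, eval_sub, eval_mul, eval_mul, eval_X, eval_C]
    linear_combination 2 * r * Real.cos θ * ih₁ - r ^ 2 * ih₀ - r ^ (n + 2) * hadd

end Dickson

section SemicircleLaw

theorem sqrt_four_mul_sub_sq_eq_zero {v t : ℝ} (ht : t ∉ Set.Ioc (-(2 * √v)) (2 * √v)) :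
    √(4 * v - t ^ 2) = 0 := by
  have hsqrt : √(4 * v) = 2 * √v := by
    rw [show (4 : ℝ) = 2 ^ 2 by norm_num, Real.sqrt_mul (by positivity), Real.sqrt_sq zero_le_two]
  have habs : 2 * √v ≤ |t| := by
    simp only [Set.mem_Ioc, not_and_or, not_lt, not_le] at ht
    exact ht.elim (fun h => le_abs.2 (.inr (le_neg_of_le_neg h))) fun h => le_abs.2 (.inl h.le)
  refine Real.sqrt_eq_zero_of_nonpos (sub_nonpos.2 ?_)
  rw [← sq_abs]
  exact (Real.sqrt_le_left (abs_nonneg t)).1 (hsqrt ▸ habs)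

theorem sqrt_four_mul_sub_sq_cos {v θ : ℝ} (hv : 0 ≤ v) (hθ : θ ∈ Set.Icc 0 Real.pi) :
    √(4 * v - (2 * √v * Real.cos θ) ^ 2) = 2 * √v * Real.sin θ := by
  have hsin := Real.sin_nonneg_of_mem_Icc hθ
  rw [← Real.sqrt_sq (by positivity : 0 ≤ 2 * √v * Real.sin θ)]
  congr 1
  linear_combination (-4 * v) * Real.sin_sq_add_cos_sq θ +
    (-4 * (Real.sin θ ^ 2 + Real.cos θ ^ 2)) * Real.sq_sqrt hv

theorem integrable_semicircleLaw (v : ℝ) {E : Type*} [NormedAddCommGroup E] [NormedSpace ℝ E]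
    {g : ℝ → E} (hg : Continuous g) :
    Integrable g (semicircleLaw v) := by
  rw [semicircleLaw, integrable_withDensity_iff_integrable_smul' (by fun_prop) (by simp)]
  refine Continuous.integrable_of_hasCompactSupport ?_ ?_
  · simp only [ENNReal.toReal_ofReal']
    fun_prop
  · refine HasCompactSupport.intro (isCompact_Icc (a := -(2 * √v)) (b := 2 * √v)) fun t ht => ?_
    simp [sqrt_four_mul_sub_sq_eq_zero fun h => ht (Set.Ioc_subset_Icc_self h)]

theorem integral_semicircleLaw_eq_intervalIntegral {v : ℝ} (hv : 0 ≤ v) (g : ℝ → ℝ) :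
    ∫ t, g t ∂(semicircleLaw v) =
      ∫ t in (-(2 * √v))..(2 * √v), √(4 * v - t ^ 2) / (2 * Real.pi * v) * g t := by
  rw [semicircleLaw, integral_withDensity_eq_integral_toReal_smul (by fun_prop) (by simp),
    intervalIntegral.integral_of_le (by linarith [Real.sqrt_nonneg v]),
    setIntegral_eq_integral_of_forall_compl_eq_zero fun t ht => by
      rw [sqrt_four_mul_sub_sq_eq_zero ht, zero_div, zero_mul]]
  refine integral_congr_ae (.of_forall fun t => ?_)
  beta_reduce
  rw [smul_eq_mul, ENNReal.toReal_ofReal (by positivity)]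

theorem integral_semicircleLaw_eq_integral_cos {v : ℝ} (hv : 0 < v) {g : ℝ → ℝ}
    (hg : Continuous g) :
    ∫ t, g t ∂(semicircleLaw v) =
      2 / Real.pi * ∫ θ in 0..Real.pi, g (2 * √v * Real.cos θ) * Real.sin θ ^ 2 := by
  have hsubst := intervalIntegral.integral_comp_mul_deriv (a := 0) (b := Real.pi)
    (g := fun t => √(4 * v - t ^ 2) / (2 * Real.pi * v) * g t)
    (fun θ _ => (Real.hasDerivAt_cos θ).const_mul (2 * √v)) (by fun_prop) (by fun_prop)
  simp only [Real.cos_zero, Real.cos_pi, mul_one, mul_neg] at hsubst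
  rw [integral_semicircleLaw_eq_intervalIntegral hv.le, intervalIntegral.integral_symm, ← hsubst,
    intervalIntegral.integral_neg, neg_neg, ← intervalIntegral.integral_const_mul]
  refine intervalIntegral.integral_congr fun θ hθ => ?_
  have hsv := Real.sqrt_pos.2 hv
  rw [Set.uIcc_of_le Real.pi_pos.le] at hθ
  rw [Function.comp_apply, sqrt_four_mul_sub_sq_cos hv.le hθ]
  field_simp
  rw [Real.sq_sqrt hv.le]
  ring

theorem integral_cos_nat_mul {n : ℕ} (hn : n ≠ 0) : ∫ θ in 0..Real.pi, Real.cos (n * θ) = 0 := by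
  rw [intervalIntegral.integral_comp_mul_left _ (Nat.cast_ne_zero.2 hn)]
  simp

theorem integral_sin_nat_mul_mul_sin (n : ℕ) :
    ∫ θ in 0..Real.pi, Real.sin ((n + 1 : ℝ) * θ) * Real.sin θ =
      if n = 0 then Real.pi / 2 else 0 := by
  have hprod (θ : ℝ) : Real.sin ((n + 1 : ℝ) * θ) * Real.sin θ =
      (Real.cos (n * θ) - Real.cos ((n + 2 : ℕ) * θ)) / 2 := by
    push_cast
    rw [show (n : ℝ) * θ = (n + 1 : ℝ) * θ - θ by ring,
      show (n + 2 : ℝ) * θ = (n + 1 : ℝ) * θ + θ by ring, Real.cos_sub, Real.cos_add]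
    ring
  simp only [hprod]
  rw [intervalIntegral.integral_div,
    intervalIntegral.integral_sub (Continuous.intervalIntegrable (by fun_prop) _ _)
      (Continuous.intervalIntegrable (by fun_prop) _ _),
    integral_cos_nat_mul (n + 1).succ_ne_zero, sub_zero]
  split_ifs with hn
  · simp [hn]
  · rw [integral_cos_nat_mul hn, zero_div]

theorem integral_dickson_two_semicircleLaw {v : ℝ} (hv : 0 < v) (n : ℕ) :
    ∫ t, (dickson 2 v n).eval t ∂(semicircleLaw v) = if n = 0 then 1 else 0 := by
  have integrand_eq (θ : ℝ) : (dickson 2 v n).eval (2 * √v * Real.cos θ) * Real.sin θ ^ 2 =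
      √v ^ n * (Real.sin ((n + 1 : ℝ) * θ) * Real.sin θ) := by
    have h := eval_dickson_two_mul_sin √v θ n
    rw [Real.sq_sqrt hv.le] at h
    rw [sq, ← mul_assoc, h, mul_assoc]
  rw [integral_semicircleLaw_eq_integral_cos hv (dickson 2 v n).continuous]
  simp only [integrand_eq]
  rw [intervalIntegral.integral_const_mul, integral_sin_nat_mul_mul_sin]
  split_ifs with hn
  · simp [hn, Real.pi_ne_zero]
  · simp

theorem integral_odd_pow_semicircleLaw (v : ℝ) {m : ℕ} (hm : Odd m) :
    ∫ t, t ^ m ∂(semicircleLaw v) = 0 := by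
  rw [semicircleLaw, integral_withDensity_eq_integral_toReal_smul (by fun_prop) (by simp)]
  have h := integral_neg_eq_self (fun t : ℝ =>
    (ENNReal.ofReal (√(4 * v - t ^ 2) / (2 * Real.pi * v))).toReal • t ^ m) volume
  simp only [neg_sq, hm.neg_pow, smul_neg, integral_neg] at h
  exact CharZero.neg_eq_self_iff.1 h

theorem succ_mul_cast_centralBinom_succ (n : ℕ) :
    ((n : ℝ) + 1) * (n + 1).centralBinom = 2 * (2 * n + 1) * n.centralBinom := by
  exact_mod_cast n.succ_mul_centralBinom_succ

theorem four_mul_cast_centralBinom_sub (n : ℕ) :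
    (4 : ℝ) * n.centralBinom - (n + 1).centralBinom = 2 * catalan n := by
  have hcat : ((n : ℝ) + 1) * catalan n = n.centralBinom := by
    exact_mod_cast succ_mul_catalan_eq_centralBinom n
  refine mul_left_cancel₀ n.cast_add_one_ne_zero ?_
  linear_combination -succ_mul_cast_centralBinom_succ n - 2 * hcat

theorem integral_cos_pow_two_mul (n : ℕ) :
    ∫ θ in 0..Real.pi, Real.cos θ ^ (2 * n) = Real.pi * n.centralBinom / 4 ^ n := by
  induction n with
  | zero => simp
  | succ n ih =>
    rw [mul_add_one, integral_cos_pow, ih]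
    simp only [Real.sin_pi, Real.sin_zero, mul_zero, sub_zero, zero_div, zero_add]
    push_cast
    field_simp
    linear_combination -2 * 4 ^ n * succ_mul_cast_centralBinom_succ n

theorem integral_even_pow_semicircleLaw {v : ℝ} (hv : 0 < v) (n : ℕ) :
    ∫ t, t ^ (2 * n) ∂(semicircleLaw v) = catalan n * v ^ n := by
  have integrand_eq (θ : ℝ) : (2 * √v * Real.cos θ) ^ (2 * n) * Real.sin θ ^ 2 =
      4 ^ n * v ^ n * (Real.cos θ ^ (2 * n) - Real.cos θ ^ (2 * (n + 1))) := by
    rw [Real.sin_sq, mul_pow, mul_pow, pow_mul 2, pow_mul √v, Real.sq_sqrt hv.le]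
    ring
  rw [integral_semicircleLaw_eq_integral_cos hv (by fun_prop)]
  simp only [integrand_eq]
  rw [intervalIntegral.integral_const_mul,
    intervalIntegral.integral_sub (Continuous.intervalIntegrable (by fun_prop) _ _)
      (Continuous.intervalIntegrable (by fun_prop) _ _),
    integral_cos_pow_two_mul, integral_cos_pow_two_mul]
  have hpi := Real.pi_ne_zero
  field_simp
  linear_combination 2 * 4 ^ n * four_mul_cast_centralBinom_sub n

end SemicircleLaw

section Semicircular

/-- The semicircle law of variance `v` as a linear functional on complex polynomials. -/
noncomputable def semicircleFunctional (v : ℝ) : ℂ[X] →ₗ[ℂ] ℂ where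
  toFun p := ∫ t : ℝ, p.eval (t : ℂ) ∂(semicircleLaw v)
  map_add' p q := by
    simp only [eval_add]
    exact integral_add (integrable_semicircleLaw v (by fun_prop))
      (integrable_semicircleLaw v (by fun_prop))
  map_smul' a p := by
    simp only [eval_smul, integral_smul, RingHom.id_apply]

theorem semicircleFunctional_apply (v : ℝ) (p : ℂ[X]) :
    semicircleFunctional v p = ∫ t : ℝ, p.eval (t : ℂ) ∂(semicircleLaw v) :=
  rfl

theorem semicircleFunctional_map_ofReal (v : ℝ) (p : ℝ[X]) :
    semicircleFunctional v (p.map Complex.ofRealHom) =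
      ((∫ t, p.eval t ∂(semicircleLaw v) : ℝ) : ℂ) := by
  rw [semicircleFunctional_apply, ← integral_complex_ofReal]
  exact integral_congr_ae (.of_forall fun t => eval_map_apply Complex.ofRealHom t)

theorem semicircleFunctional_dickson_two {v : ℝ} (hv : 0 < v) (n : ℕ) :
    semicircleFunctional v (dickson 2 (v : ℂ) n) = if n = 0 then 1 else 0 := by
  have h := semicircleFunctional_map_ofReal v (dickson 2 v n)
  rw [map_dickson, integral_dickson_two_semicircleLaw hv] at h
  exact_mod_cast h

variable {A : Type*} [Ring A] [Algebra ℂ A] [StarRing A]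

theorem isSemicircular_iff_comp_aeval_eq {φ : A →ₗ[ℂ] ℂ} {v : ℝ} {x : A} :
    IsSemicircular φ v x ↔
      IsSelfAdjoint x ∧ φ ∘ₗ (aeval x).toLinearMap = semicircleFunctional v := by
  refine and_congr_right fun _ => ?_
  have hmoment (m : ℕ) : semicircleFunctional v (X ^ m) =
      ((∫ t, t ^ m ∂(semicircleLaw v) : ℝ) : ℂ) := by
    simpa using semicircleFunctional_map_ofReal v (X ^ m)
  refine ⟨fun h => lhom_ext' fun m => LinearMap.ext_ring ?_, fun h m => ?_⟩
  · simpa [← X_pow_eq_monomial, hmoment] using h m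
  · simpa [hmoment] using LinearMap.congr_fun h (X ^ m)

theorem isSemicircular_iff_forall_aeval_dickson_two {φ : A →ₗ[ℂ] ℂ} {v : ℝ} (hv : 0 < v) {x : A} :
    IsSemicircular φ v x ↔
      IsSelfAdjoint x ∧ ∀ n, φ (aeval x (dickson 2 (v : ℂ) n)) = if n = 0 then 1 else 0 := by
  rw [isSemicircular_iff_comp_aeval_eq]
  refine and_congr_right fun _ => ⟨fun h n => ?_, fun h => ?_⟩
  · rw [← semicircleFunctional_dickson_two hv, ← h]
    rfl
  · refine LinearMap.ext_on_range (span_range_dickson_two (v : ℂ)) fun n => ?_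
    exact (h n).trans (semicircleFunctional_dickson_two hv n).symm

end Semicircular

section Freeness

variable {A ι : Type*} [Ring A] [Algebra ℂ A]

theorem FreeSubalgebras.of_mem_span {φ : A →ₗ[ℂ] ℂ} {B : ι → Subalgebra ℂ A} (S : ι → Set A)
    (hspan : ∀ i, ∀ b ∈ B i, φ b = 0 → b ∈ Submodule.span ℂ (S i))
    (hφ : ∀ l : List (ι × A), l ≠ [] → l.IsChain (fun p q => p.1 ≠ q.1) →
      (∀ p ∈ l, p.2 ∈ S p.1) → φ (l.map Prod.snd).prod = 0) :
    FreeSubalgebras φ B := by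
  suffices key : ∀ l₂ l₁ : List (ι × A), l₁ ++ l₂ ≠ [] →
      (l₁ ++ l₂).IsChain (fun p q => p.1 ≠ q.1) → (∀ p ∈ l₁, p.2 ∈ S p.1) →
      (∀ p ∈ l₂, p.2 ∈ Submodule.span ℂ (S p.1)) → φ ((l₁ ++ l₂).map Prod.snd).prod = 0 from
    fun l hl hchain hmem =>
      key l [] hl hchain (by simp) fun p hp => hspan p.1 p.2 (hmem p hp).1 (hmem p hp).2
  intro l₂
  induction l₂ with
  | nil =>
    intro l₁ hl hchain hS _
    rw [List.append_nil] at hl hchain ⊢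
    exact hφ l₁ hl hchain hS
  | cons p l₂ ih =>
    obtain ⟨i, b⟩ := p
    intro l₁ hl hchain hS hmem
    have hb : b ∈ Submodule.span ℂ (S i) := hmem (i, b) List.mem_cons_self
    replace hmem := fun p hp => hmem p (List.mem_cons_of_mem (i, b) hp)
    have hchain' (c : A) : ((l₁ ++ [(i, c)]) ++ l₂).IsChain (fun p q => p.1 ≠ q.1) := by
      rw [List.append_assoc, List.singleton_append, ← List.isChain_map (R := (· ≠ ·)) Prod.fst,
        List.map_append, List.map_cons]
      simpa using (List.isChain_map (R := (· ≠ ·)) Prod.fst).2 hchain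
    suffices φ ((l₁.map Prod.snd).prod * b * (l₂.map Prod.snd).prod) = 0 by
      simpa [mul_assoc] using this
    clear hl hchain
    induction hb using Submodule.span_induction with
    | mem c hc =>
      have h := ih (l₁ ++ [(i, c)]) (by simp) (hchain' c) ?_ hmem
      · simpa [mul_assoc] using h
      · simpa [or_imp, forall_and] using ⟨fun j d h => hS (j, d) h, hc⟩
    | zero => simp
    | add c d _ _ hc hd => rw [mul_add, add_mul, map_add, hc, hd, add_zero]
    | smul r c _ hc => rw [mul_smul_comm, smul_mul_assoc, map_smul, hc, smul_zero]

theorem mem_span_aeval_dickson_two_of_mem_adjoin {φ : A →ₗ[ℂ] ℂ} (hφ : φ 1 = 1) {x : A} {v : ℂ}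
    (hx : ∀ n, φ (aeval x (dickson 2 v (n + 1))) = 0) {b : A} (hb : b ∈ Algebra.adjoin ℂ {x})
    (hφb : φ b = 0) :
    b ∈ Submodule.span ℂ (Set.range fun n => aeval x (dickson 2 v (n + 1))) := by
  rw [Algebra.adjoin_singleton_eq_range_aeval] at hb
  obtain ⟨p, rfl⟩ := hb
  obtain ⟨a, q, hq, rfl⟩ := exists_smul_one_add_mem_span_dickson_two v p
  have hq' := Submodule.mem_map_of_mem (f := (aeval x).toLinearMap) hq
  rw [Submodule.map_span, ← Set.range_comp] at hq'
  have hφq : φ (aeval x q) = 0 := by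
    refine (Submodule.span_le (p := LinearMap.ker φ)).2 ?_ hq'
    rintro _ ⟨n, rfl⟩
    exact hx n
  have ha : a = 0 := by
    simpa [hφ, hφq] using hφb
  simpa [ha, Function.comp_def] using hq'

end Freeness

section WickWord

theorem exists_flatMap_replicate_eq {ι : Type*} (w : List ι) :
    ∃ l : List (ι × ℕ), l.IsChain (fun p q => p.1 ≠ q.1) ∧
      (l.flatMap fun p => List.replicate (p.2 + 1) p.1) = w := by
  induction w with
  | nil => exact ⟨[], .nil, rfl⟩
  | cons i w ih =>
    obtain ⟨l, hl, rfl⟩ := ih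
    cases l with
    | nil => exact ⟨[(i, 0)], .singleton _, rfl⟩
    | cons p l =>
      obtain ⟨j, n⟩ := p
      by_cases hij : i = j
      · subst hij
        refine ⟨(i, n + 1) :: l, ?_, by simp [List.replicate_succ]⟩
        cases l with
        | nil => exact .singleton _
        | cons q l => exact .cons_cons hl.rel hl.tail
      · exact ⟨(i, 0) :: (j, n) :: l, .cons_cons hij hl, rfl⟩

variable {R A ι : Type*} [CommRing R] [Ring A] [Algebra R A] [DecidableEq ι]

/-- The Wick word (free Chebyshev polynomial) of the letters `i₁, …, iₙ`, with variance `v`: the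
noncommutative polynomial in the `x i` obtained from `x i₁ ⋯ x iₙ` by subtracting the contractions
of adjacent equal letters. For a free semicircular family of variance `v`, the Wick words of
nonempty words are centered. -/
def wickWord (v : R) (x : ι → A) : List ι → A
  | [] => 1
  | [i] => x i
  | i :: j :: w => x i * wickWord v x (j :: w) - if i = j then v • wickWord v x w else 0

theorem wickWord_replicate_append (v : R) (x : ι → A) {i : ι} (n : ℕ) {w : List ι}
    (hw : i ∉ w.head?) :
    wickWord v x (List.replicate n i ++ w) = aeval (x i) (dickson 2 v n) * wickWord v x w := by
  induction n using Nat.twoStepInduction with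
  | zero => rw [dickson_two_zero, map_one, one_mul, List.replicate_zero, List.nil_append]
  | one =>
    cases w with
    | nil => simp [wickWord]
    | cons j w =>
      have hij : i ≠ j := fun h => hw (by simp [h])
      simp [wickWord, hij]
  | more n ih₀ ih₁ =>
    simp only [List.replicate_succ, List.cons_append, wickWord, if_true] at ih₀ ih₁ ⊢
    rw [ih₀, ih₁, dickson_add_two, ← smul_eq_C_mul]
    simp [sub_mul, mul_assoc]

theorem wickWord_flatMap_replicate (v : R) (x : ι → A) {l : List (ι × ℕ)}
    (hl : l.IsChain (fun p q => p.1 ≠ q.1)) :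
    wickWord v x (l.flatMap fun p => List.replicate (p.2 + 1) p.1) =
      (l.map fun p => aeval (x p.1) (dickson 2 v (p.2 + 1))).prod := by
  induction l with
  | nil => simp [wickWord]
  | cons p l ih =>
    rw [List.flatMap_cons, wickWord_replicate_append, ih hl.tail, List.map_cons, List.prod_cons]
    cases l with
    | nil => simp
    | cons q l => simpa [List.replicate_succ] using hl.rel.symm

end WickWord

section FreeSemicircularFamily

variable {A ι : Type*} [Ring A] [Algebra ℂ A] [StarRing A] [DecidableEq ι]

theorem IsFreeSemicircularFamily.map_wickWord {φ : A →ₗ[ℂ] ℂ} {v : ℝ} (hv : 0 < v) {x : ι → A}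
    (hx : IsFreeSemicircularFamily φ v x) {w : List ι} (hw : w ≠ []) :
    φ (wickWord (v : ℂ) x w) = 0 := by
  obtain ⟨l, hl, rfl⟩ := exists_flatMap_replicate_eq w
  have hprod := hx.2 (l.map fun p => (p.1, aeval (x p.1) (dickson 2 (v : ℂ) (p.2 + 1))))
    (fun hnil => hw (by rw [List.map_eq_nil_iff.1 hnil, List.flatMap_nil]))
    (by rwa [List.isChain_map]) ?_
  · rw [wickWord_flatMap_replicate _ _ hl]
    rwa [List.map_map] at hprod
  · rw [List.forall_mem_map]
    refine fun p _ => ⟨aeval_mem_adjoin_singleton ℂ (x p.1), ?_⟩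
    simpa using ((isSemicircular_iff_forall_aeval_dickson_two hv).1 (hx.1 p.1)).2 (p.2 + 1)

theorem IsFreeSemicircularFamily.of_map_wickWord {φ : A →ₗ[ℂ] ℂ} (hφ : φ 1 = 1) {v : ℝ}
    (hv : 0 < v) {x : ι → A} (hx : ∀ i, IsSelfAdjoint (x i))
    (hwick : ∀ w ≠ [], φ (wickWord (v : ℂ) x w) = 0) :
    IsFreeSemicircularFamily φ v x := by
  have hdickson (i : ι) (n : ℕ) : φ (aeval (x i) (dickson 2 (v : ℂ) (n + 1))) = 0 := by
    have h := wickWord_replicate_append (v : ℂ) x (n + 1) (w := []) (i := i) (by simp)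
    rw [wickWord, mul_one] at h
    exact h ▸ hwick _ (by simp)
  refine ⟨fun i => (isSemicircular_iff_forall_aeval_dickson_two hv).2 ⟨hx i, fun n => ?_⟩,
    .of_mem_span (fun i => Set.range fun n => aeval (x i) (dickson 2 (v : ℂ) (n + 1)))
      (fun i b => mem_span_aeval_dickson_two_of_mem_adjoin hφ (hdickson i))
      fun l hl hchain hmem => ?_⟩
  · cases n with
    | zero => rw [dickson_two_zero, map_one, hφ, if_pos rfl]
    | succ n => exact hdickson i n
  · obtain ⟨l, rfl⟩ : l ∈ Set.range (List.map fun p : ι × ℕ =>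
        (p.1, aeval (x p.1) (dickson 2 (v : ℂ) (p.2 + 1)))) := by
      rw [Set.range_list_map]
      rintro ⟨i, b⟩ hb
      obtain ⟨n, hn⟩ := hmem _ hb
      exact ⟨(i, n), Prod.ext rfl hn⟩
    rw [List.isChain_map] at hchain
    rw [List.map_map]
    refine (congrArg φ (wickWord_flatMap_replicate _ _ hchain)).symm.trans (hwick _ ?_)
    cases l with
    | nil => exact absurd rfl hl
    | cons p l => simp [List.replicate_succ]

end FreeSemicircularFamily

section PathSum

variable {R n κ ι M : Type*} [CommRing R] [Fintype n] [DecidableEq n] [AddCommGroup M] [Module R M]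

/-- The sum of `α a c₁ * α c₁ c₂ * ⋯ • F [f a c₁ k₁, f c₁ c₂ k₂, …]` over the paths
`a, c₁, c₂, …, b` along the word `k₁, k₂, …`, as a linear function of `F`: this is how an entry of
a product of matrices depends on the entries of its factors. -/
def pathSum (α : n → n → R) (f : n → n → κ → ι) : List κ → n → n → (List ι → M) →ₗ[R] M
  | [], a, b => if a = b then LinearMap.proj [] else 0
  | k :: w, a, b => ∑ c, α a c • (pathSum α f w c b ∘ₗ LinearMap.funLeft R M (f a c k :: ·))

theorem pathSum_nil_apply (α : n → n → R) (f : n → n → κ → ι) (a b : n) (F : List ι → M) :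
    pathSum α f [] a b F = if a = b then F [] else 0 := by
  rw [pathSum]
  split_ifs <;> rfl

theorem pathSum_cons_apply (α : n → n → R) (f : n → n → κ → ι) (k : κ) (w : List κ) (a b : n)
    (F : List ι → M) :
    pathSum α f (k :: w) a b F =
      ∑ c, α a c • pathSum α f w c b (fun u => F (f a c k :: u)) := by
  simp only [pathSum, LinearMap.sum_apply]
  rfl

theorem map_pathSum {M' : Type*} [AddCommGroup M'] [Module R M'] (L : M →ₗ[R] M')
    (α : n → n → R) (f : n → n → κ → ι) (w : List κ) (a b : n) (F : List ι → M) :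
    L (pathSum α f w a b F) = pathSum α f w a b (L ∘ F) := by
  induction w generalizing a F with
  | nil => simp only [pathSum_nil_apply, apply_ite L, map_zero, Function.comp_apply]
  | cons k w ih =>
    simp only [pathSum_cons_apply, map_sum, map_smul, ih]
    rfl

theorem pathSum_eq_zero {α : n → n → R} {f : n → n → κ → ι} {w : List κ} {F : List ι → M}
    (hF : ∀ u, u.length = w.length → F u = 0) (a b : n) : pathSum α f w a b F = 0 := by
  induction w generalizing a F with
  | nil => rw [pathSum_nil_apply, hF [] rfl, ite_self]
  | cons k w ih =>
    rw [pathSum_cons_apply]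
    refine Finset.sum_eq_zero fun c _ => ?_
    rw [ih (fun u hu => hF _ (congrArg (· + 1) hu)), smul_zero]

variable [DecidableEq ι] [DecidableEq κ]

theorem sum_smul_sum_smul_pathSum_ite {α : n → n → R} {f : n → n → κ → ι} {r : R}
    (hα : ∀ a, ∑ c, α a c * α c a = r)
    (hf : ∀ a c d k l, f a c k = f c d l ↔ a = d ∧ k = l) (v : R) (k l : κ) (w : List κ)
    (a b : n) (F : List ι → M) :
    ∑ c, α a c • ∑ d, α c d • pathSum α f w d b
        (fun u => if f a c k = f c d l then v • F u else 0) =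
      if k = l then (v * r) • pathSum α f w a b F else 0 := by
  have hterm (c d : n) :
      pathSum α f w d b (fun u => if f a c k = f c d l then v • F u else 0) =
        if a = d then if k = l then v • pathSum α f w a b F else 0 else 0 := by
    simp only [hf, ite_and]
    split_ifs with had hkl
    · subst had
      exact map_smul (pathSum α f w a b) v F
    · exact map_zero _
    · exact map_zero _
  simp only [hterm, smul_ite, smul_zero, Finset.sum_ite_eq, Finset.mem_univ, if_true]
  split_ifs
  · rw [mul_comm, mul_smul, ← hα a, Finset.sum_smul]
    simp only [mul_smul]
  · exact Finset.sum_const_zero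

theorem wickWord_matrix_apply {A : Type*} [Ring A] [Algebra R A]
    {α : n → n → R} {f : n → n → κ → ι} {r : R} (hα : ∀ a, ∑ c, α a c * α c a = r)
    (hf : ∀ a c d k l, f a c k = f c d l ↔ a = d ∧ k = l)
    {x : ι → A} {X : κ → Matrix n n A} (hX : ∀ k a b, X k a b = α a b • x (f a b k))
    (v : R) (w : List κ) (a b : n) :
    wickWord (v * r) X w a b = pathSum α f w a b (wickWord v x) := by
  induction w using List.twoStepInduction generalizing a with
  | nil => rw [pathSum_nil_apply, wickWord, wickWord, Matrix.one_apply]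
  | singleton k => simp [pathSum_cons_apply, pathSum_nil_apply, wickWord, hX]
  | cons_cons k l w ih₀ ih₁ =>
    have hsplit (c d : n) :
        pathSum α f w d b (fun u => wickWord v x (f a c k :: f c d l :: u)) =
          x (f a c k) * pathSum α f w d b (fun u => wickWord v x (f c d l :: u)) -
            pathSum α f w d b
              (fun u => if f a c k = f c d l then v • wickWord v x u else 0) := by
      rw [eq_comm, ← LinearMap.mulLeft_apply R, map_pathSum, ← map_sub]
      rfl
    have hcontract := sum_smul_sum_smul_pathSum_ite hα hf v k l w a b (wickWord v x)
    simp only [pathSum_cons_apply, hsplit, smul_sub, Finset.sum_sub_distrib, hcontract]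
    rw [wickWord, Matrix.sub_apply, Matrix.mul_apply]
    congr 1
    · refine Finset.sum_congr rfl fun c _ => ?_
      rw [ih₁, hX, pathSum_cons_apply, smul_mul_assoc, Finset.mul_sum]
      simp only [mul_smul_comm]
    · split_ifs
      · rw [Matrix.smul_apply, ih₀]
      · rfl

end PathSum

section SemicircularMatrix

/-- The index of the variable in the `(a, b)` entry of the `k`-th semicircular matrix. -/
def entryIndex {N : ℕ} (a b : Fin N) (k : ℕ+) : {q : Fin N × Fin N × ℕ+ // q.1 ≤ q.2.1} :=
  ⟨(min a b, max a b, k), min_le_max⟩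

theorem entryIndex_eq_iff {N : ℕ} (a c d : Fin N) (k l : ℕ+) :
    entryIndex a c k = entryIndex c d l ↔ a = d ∧ k = l := by
  simp only [entryIndex, Subtype.mk.injEq, Prod.mk.injEq]
  refine ⟨fun ⟨hmin, hmax, hkl⟩ => ⟨?_, hkl⟩, ?_⟩
  · exact eq_of_inf_eq_sup_eq (hmin.trans (min_comm c d)) (hmax.trans (max_comm c d))
  · rintro ⟨rfl, rfl⟩
    exact ⟨min_comm _ _, max_comm _ _, rfl⟩

/-- The coefficient of the variable in the `(a, b)` entry of a semicircular matrix. -/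
noncomputable def entryCoeff {N : ℕ} (a b : Fin N) : ℂ :=
  ((√(1 + if a = b then 1 else 0) / √N : ℝ) : ℂ)

theorem entryCoeff_comm {N : ℕ} (a b : Fin N) : entryCoeff a b = entryCoeff b a := by
  simp only [entryCoeff, eq_comm]

theorem sum_entryCoeff_mul {N : ℕ} (a : Fin N) :
    ∑ c, entryCoeff a c * entryCoeff c a = ((1 + 1 / N : ℝ) : ℂ) := by
  have hN : (N : ℝ) ≠ 0 := Nat.cast_ne_zero.2 a.pos.ne'
  have hsq (c : Fin N) : entryCoeff a c * entryCoeff c a =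
      (((1 + if a = c then 1 else 0) / N : ℝ) : ℂ) := by
    rw [entryCoeff_comm c a, entryCoeff, ← Complex.ofReal_mul, div_mul_div_comm,
      Real.mul_self_sqrt (by split_ifs <;> norm_num), Real.mul_self_sqrt (Nat.cast_nonneg N)]
  simp only [hsq]
  rw [← Complex.ofReal_sum, ← Finset.sum_div, Finset.sum_add_distrib, Fin.sum_const, nsmul_one,
    Finset.sum_ite_eq, if_pos (Finset.mem_univ a), add_div, div_self hN]

variable {A : Type*} [Ring A] [Algebra ℂ A]

theorem matrixFunctional_apply {N : ℕ} (ψ : A →ₗ[ℂ] ℂ) (M : Matrix (Fin N) (Fin N) A) :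
    matrixFunctional N ψ M = (N : ℂ)⁻¹ * ∑ a, ψ (M a a) := by
  simp [matrixFunctional, Matrix.trace]

theorem matrixFunctional_one {N : ℕ} (hN : N ≠ 0) {ψ : A →ₗ[ℂ] ℂ} (hψ : ψ 1 = 1) :
    matrixFunctional N ψ 1 = 1 := by
  simp [matrixFunctional_apply, hψ, hN]

theorem semicircularMatrix_apply {N : ℕ} (s : Fin N → Fin N → ℕ+ → A) (k : ℕ+) (a b : Fin N) :
    semicircularMatrix N s k a b = entryCoeff a b • s (min a b) (max a b) k :=
  rfl

variable [StarRing A] [StarModule ℂ A]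

theorem isSelfAdjoint_semicircularMatrix {N : ℕ} {s : Fin N → Fin N → ℕ+ → A} {k : ℕ+}
    (hs : ∀ i j, i ≤ j → IsSelfAdjoint (s i j k)) :
    IsSelfAdjoint (semicircularMatrix N s k) := by
  ext i j
  rw [Matrix.star_apply, semicircularMatrix_apply, semicircularMatrix_apply, star_smul,
    (hs _ _ min_le_max).star_eq, min_comm, max_comm, entryCoeff_comm, entryCoeff,
    Complex.star_def, Complex.conj_ofReal]

theorem isFreeSemicircularFamily_semicircularMatrix {ψ : A →ₗ[ℂ] ℂ} (hψ : ψ 1 = 1) {N : ℕ}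
    (hN : N ≠ 0) {s : Fin N → Fin N → ℕ+ → A} {v : ℝ} (hv : 0 < v)
    (hs : IsFreeSemicircularFamily ψ v
      (fun p : {q : Fin N × Fin N × ℕ+ // q.1 ≤ q.2.1} => s p.1.1 p.1.2.1 p.1.2.2)) :
    IsFreeSemicircularFamily (matrixFunctional N ψ) (v * (1 + 1 / N)) (semicircularMatrix N s) := by
  refine .of_map_wickWord (matrixFunctional_one hN hψ) (by positivity)
    (fun k => isSelfAdjoint_semicircularMatrix fun i j hij => (hs.1 ⟨(i, j, k), hij⟩).1)
    fun w hw => ?_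
  have hentry (a : Fin N) :
      ψ (wickWord ((v * (1 + 1 / N) : ℝ) : ℂ) (semicircularMatrix N s) w a a) = 0 := by
    rw [Complex.ofReal_mul, wickWord_matrix_apply sum_entryCoeff_mul entryIndex_eq_iff
      (x := fun p => s p.1.1 p.1.2.1 p.1.2.2) (semicircularMatrix_apply s), map_pathSum]
    refine pathSum_eq_zero (fun u hu => hs.map_wickWord hv ?_) a a
    rwa [← List.length_pos_iff, hu, List.length_pos_iff]
  simp only [matrixFunctional_apply, hentry, Finset.sum_const_zero, mul_zero]

end SemicircularMatrix

section NoncrossingPairing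

open Finset

/-- The number of noncrossing pairings of `n` points: a Catalan number, or `0` if `n` is odd. -/
def aeratedCatalan (n : ℕ) : ℕ :=
  if Even n then catalan (n / 2) else 0

theorem aeratedCatalan_two_mul (n : ℕ) : aeratedCatalan (2 * n) = catalan n := by
  simp [aeratedCatalan]

theorem aeratedCatalan_of_odd {n : ℕ} (hn : Odd n) : aeratedCatalan n = 0 :=
  if_neg (Nat.not_even_iff_odd.2 hn)

theorem aeratedCatalan_add_two (n : ℕ) :
    aeratedCatalan (n + 2) = ∑ p ∈ antidiagonal n, aeratedCatalan p.1 * aeratedCatalan p.2 := by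
  obtain ⟨m, rfl | rfl⟩ := n.even_or_odd'
  · rw [← mul_add_one, aeratedCatalan_two_mul, catalan_succ']
    refine sum_of_injOn (fun p => (2 * p.1, 2 * p.2)) ?_ ?_ ?_ ?_
    · exact fun p _ q _ h => by simpa [Prod.ext_iff] using h
    · intro p hp
      simp only [mem_coe, HasAntidiagonal.mem_antidiagonal] at hp ⊢
      omega
    · rintro ⟨i, j⟩ hij hnot
      rw [HasAntidiagonal.mem_antidiagonal] at hij
      rcases i.even_or_odd' with ⟨i, rfl | rfl⟩
      · refine absurd ⟨(i, j / 2), ?_, ?_⟩ hnot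
        · rw [mem_coe, HasAntidiagonal.mem_antidiagonal]
          omega
        · simp only [Prod.mk.injEq, true_and]
          omega
      · rw [aeratedCatalan_of_odd (odd_two_mul_add_one i), zero_mul]
    · simp only [aeratedCatalan_two_mul, implies_true]
  · rw [aeratedCatalan_of_odd ⟨m + 1, by ring⟩, eq_comm]
    refine sum_eq_zero fun p hp => mul_eq_zero.2 ?_
    have hodd : Odd (p.1 + p.2) := HasAntidiagonal.mem_antidiagonal.1 hp ▸ odd_two_mul_add_one m
    rcases Nat.even_or_odd p.1 with hp₁ | hp₁
    · exact .inr (aeratedCatalan_of_odd (by grind))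
    · exact .inl (aeratedCatalan_of_odd hp₁)

variable {α : Type*} [LinearOrder α]

theorem sum_card_filter_lt_card_filter_gt {M : Type*} [AddCommMonoid M] {s : Finset α} {n : ℕ}
    (hs : #s = n + 1) (F : ℕ → ℕ → M) :
    ∑ c ∈ s, F #{x ∈ s | x < c} #{x ∈ s | c < x} = ∑ p ∈ antidiagonal n, F p.1 p.2 := by
  induction s using Finset.induction_on_max generalizing n F with
  | empty => simp at hs
  | insert m s hm ih =>
    have hmem : m ∉ s := fun h => lt_irrefl m (hm m h)
    have hlower : ({x ∈ insert m s | x < m} : Finset α) = s := by grind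
    have hupper : ({x ∈ insert m s | m < x} : Finset α) = ∅ := by grind
    have hlower' (c : α) (hc : c ∈ s) :
        ({x ∈ insert m s | x < c} : Finset α) = {x ∈ s | x < c} := by grind
    have hupper' (c : α) (hc : c ∈ s) :
        #{x ∈ insert m s | c < x} = #{x ∈ s | c < x} + 1 := by
      rw [filter_insert, if_pos (hm c hc), card_insert_of_notMem (by simp [hmem])]
    rw [card_insert_of_notMem hmem, Nat.succ_inj] at hs
    rw [sum_insert hmem, hlower, hupper, card_empty, hs]
    rw [sum_congr rfl fun c hc => by rw [hlower' c hc, hupper' c hc]]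
    cases n with
    | zero => simp [card_eq_zero.1 hs]
    | succ n =>
      rw [ih hs fun i j => F i (j + 1), Nat.sum_antidiagonal_succ']

/-- `f` is a noncrossing pairing of the finite set `s`, encoded as an involution of the whole type
whose fixed points are the elements outside `s`. -/
structure IsNoncrossingPairingOn (s : Finset α) (f : α → α) : Prop where
  apply_apply : ∀ i, f (f i) = i
  apply_ne_iff : ∀ i, f i ≠ i ↔ i ∈ s
  not_crossing : ∀ i j, ¬ (i < j ∧ j < f i ∧ f i < f j)

namespace IsNoncrossingPairingOn

variable {s t : Finset α} {f g h : α → α} {a c : α}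

theorem apply_of_notMem (hf : IsNoncrossingPairingOn s f) {i : α} (hi : i ∉ s) : f i = i :=
  not_not.1 fun h => hi ((hf.apply_ne_iff i).1 h)

theorem apply_mem (hf : IsNoncrossingPairingOn s f) {i : α} (hi : i ∈ s) : f i ∈ s := by
  rw [← hf.apply_ne_iff] at hi ⊢
  rw [hf.apply_apply i]
  exact hi.symm

theorem restrict (hf : IsNoncrossingPairingOn s f) (hts : t ⊆ s) (hft : ∀ i ∈ t, f i ∈ t) :
    IsNoncrossingPairingOn t fun i => if i ∈ t then f i else i := by
  have hinv := hf.apply_apply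
  have hne := hf.apply_ne_iff
  have hcross := hf.not_crossing
  constructor
  · intro i
    grind
  · grind
  · grind

end IsNoncrossingPairingOn

/-- The map pairing `a` with `c` that agrees with `g` below `c` and with `h` above `c`. -/
def gluePairing (a c : α) (g h : α → α) (i : α) : α :=
  if i = a then c else if i = c then a else if i < c then g i else h i

section Decomposition

variable {t : Finset α} {f g h : α → α} {a c : α}

theorem isNoncrossingPairingOn_gluePairing (ha : ∀ i ∈ t, a < i) (hc : c ∈ t)
    (hg : IsNoncrossingPairingOn {i ∈ t | i < c} g)
    (hh : IsNoncrossingPairingOn {i ∈ t | c < i} h) :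
    IsNoncrossingPairingOn (insert a t) (gluePairing a c g h) := by
  obtain ⟨hg_inv, hg_ne, hg_cross⟩ := id hg
  obtain ⟨hh_inv, hh_ne, hh_cross⟩ := id hh
  have hg_mem := @hg.apply_mem
  have hh_mem := @hh.apply_mem
  have hg_fix := @hg.apply_of_notMem
  have hh_fix := @hh.apply_of_notMem
  simp only [mem_filter] at *
  constructor <;> grind [gluePairing]

theorem IsNoncrossingPairingOn.apply_mem_filter_lt (hf : IsNoncrossingPairingOn (insert a t) f)
    (ha : ∀ i ∈ t, a < i) (hfa : f a = c) {i : α} (hi : i ∈ {i ∈ t | i < c}) :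
    f i ∈ {i ∈ t | i < c} := by
  have hmem := @hf.apply_mem
  obtain ⟨hinv, -, hcross⟩ := hf
  grind

theorem IsNoncrossingPairingOn.apply_mem_filter_gt (hf : IsNoncrossingPairingOn (insert a t) f)
    (ha : ∀ i ∈ t, a < i) (hfa : f a = c) {i : α} (hi : i ∈ {i ∈ t | c < i}) :
    f i ∈ {i ∈ t | c < i} := by
  have hmem := @hf.apply_mem
  obtain ⟨hinv, -, hcross⟩ := hf
  grind

end Decomposition

section Count

variable [Fintype α]

open scoped Classical in
/-- The finite set of noncrossing pairings of `s`. -/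
noncomputable def noncrossingPairings (s : Finset α) : Finset (α → α) :=
  {f | IsNoncrossingPairingOn s f}

theorem mem_noncrossingPairings {s : Finset α} {f : α → α} :
    f ∈ noncrossingPairings s ↔ IsNoncrossingPairingOn s f := by
  simp [noncrossingPairings]

theorem card_filter_apply_eq_noncrossingPairings_insert {t : Finset α} {a c : α}
    (ha : ∀ i ∈ t, a < i) (hc : c ∈ t) :
    #{f ∈ noncrossingPairings (insert a t) | f a = c} =
      #(noncrossingPairings {i ∈ t | i < c}) * #(noncrossingPairings {i ∈ t | c < i}) := by
  rw [← card_product]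
  refine card_nbij'
    (fun f => (fun i => if i ∈ ({i ∈ t | i < c} : Finset α) then f i else i,
      fun i => if i ∈ ({i ∈ t | c < i} : Finset α) then f i else i))
    (fun p => gluePairing a c p.1 p.2) ?_ ?_ ?_ ?_
  · intro f hf
    simp only [mem_coe, mem_filter, mem_noncrossingPairings] at hf
    have hsub (p : α → Prop) [DecidablePred p] : {i ∈ t | p i} ⊆ insert a t :=
      (filter_subset p t).trans (subset_insert a t)
    rw [mem_coe, mem_product, mem_noncrossingPairings, mem_noncrossingPairings]
    exact ⟨hf.1.restrict (hsub _) fun i => hf.1.apply_mem_filter_lt ha hf.2,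
      hf.1.restrict (hsub _) fun i => hf.1.apply_mem_filter_gt ha hf.2⟩
  · rintro ⟨g, h⟩ hgh
    simp only [mem_coe, mem_filter, mem_product, mem_noncrossingPairings] at hgh ⊢
    exact ⟨isNoncrossingPairingOn_gluePairing ha hc hgh.1 hgh.2, if_pos rfl⟩
  · intro f hf
    simp only [mem_coe, mem_filter, mem_noncrossingPairings] at hf
    ext i
    have hfix := @hf.1.apply_of_notMem
    have hinv := hf.1.apply_apply
    grind [gluePairing]
  · rintro ⟨g, h⟩ hgh
    simp only [mem_coe, mem_product, mem_noncrossingPairings] at hgh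
    have hg_fix := @hgh.1.apply_of_notMem
    have hh_fix := @hgh.2.apply_of_notMem
    simp only [Prod.mk.injEq]
    constructor <;> ext i <;> grind [gluePairing]

theorem noncrossingPairings_empty : noncrossingPairings (∅ : Finset α) = {id} := by
  ext f
  rw [mem_noncrossingPairings, mem_singleton]
  constructor
  · exact fun hf => funext fun i => hf.apply_of_notMem (notMem_empty i)
  · rintro rfl
    exact ⟨fun _ => rfl, by simp, fun i j h => lt_asymm h.1 h.2.1⟩

theorem card_noncrossingPairings_insert {t : Finset α} {a : α} (ha : ∀ i ∈ t, a < i) :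
    #(noncrossingPairings (insert a t)) =
      ∑ c ∈ t, #(noncrossingPairings {i ∈ t | i < c}) * #(noncrossingPairings {i ∈ t | c < i}) := by
  have hmaps (f : α → α) (hf : f ∈ noncrossingPairings (insert a t)) : f a ∈ t := by
    rw [mem_noncrossingPairings] at hf
    exact mem_of_mem_insert_of_ne (hf.apply_mem (mem_insert_self a t))
      ((hf.apply_ne_iff a).2 (mem_insert_self a t))
  rw [card_eq_sum_card_fiberwise hmaps]
  exact sum_congr rfl fun c hc => card_filter_apply_eq_noncrossingPairings_insert ha hc

theorem card_noncrossingPairings (s : Finset α) :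
    #(noncrossingPairings s) = aeratedCatalan #s := by
  induction s using Finset.strongInduction with
  | _ s ih =>
    rcases s.eq_empty_or_nonempty with rfl | hs
    · simp [noncrossingPairings_empty, aeratedCatalan]
    obtain ⟨a, t, hat, rfl, ha⟩ : ∃ a t, a ∉ t ∧ insert a t = s ∧ ∀ i ∈ t, a < i :=
      ⟨s.min' hs, s.erase (s.min' hs), notMem_erase _ s, insert_erase (s.min'_mem hs),
        fun _ => s.min'_lt_of_mem_erase_min' hs⟩
    have hfilter (p : α → Prop) [DecidablePred p] :
        #(noncrossingPairings {i ∈ t | p i}) = aeratedCatalan #{i ∈ t | p i} :=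
      ih _ ((filter_subset p t).trans_ssubset (ssubset_insert hat))
    rw [card_noncrossingPairings_insert ha, card_insert_of_notMem hat]
    simp only [hfilter]
    cases hn : #t with
    | zero => simp [card_eq_zero.1 hn, aeratedCatalan]
    | succ n =>
      rw [sum_card_filter_lt_card_filter_gt hn fun i j => aeratedCatalan i * aeratedCatalan j,
        aeratedCatalan_add_two]

end Count

theorem isNoncrossingPairing_iff {m : ℕ} {f : Fin m → Fin m} :
    IsNoncrossingPairing f ↔ IsNoncrossingPairingOn univ f :=
  ⟨fun h => ⟨h.1, fun i => by simp [h.2.1 i], h.2.2⟩,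
    fun h => ⟨h.apply_apply, fun i => (h.apply_ne_iff i).2 (mem_univ i), h.not_crossing⟩⟩

theorem numNoncrossingPairings_eq_catalan (n : ℕ) : numNoncrossingPairings n = catalan n := by
  have hcard := card_noncrossingPairings (univ : Finset (Fin (2 * n)))
  rw [card_univ, Fintype.card_fin, aeratedCatalan_two_mul] at hcard
  simp only [numNoncrossingPairings, isNoncrossingPairing_iff, ← mem_noncrossingPairings]
  rw [Nat.card_eq_finsetCard, hcard]

end NoncrossingPairing

end FreeProb

open FreeProb in
theorem mainTheorem8 {A : Type*} [Ring A] [StarRing A] [Algebra ℂ A] [StarModule ℂ A]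
    (ψ : A →ₗ[ℂ] ℂ) (hψ : ψ 1 = 1) (N : ℕ) (hN : 1 ≤ N)
    (s : Fin N → Fin N → ℕ+ → A)
    (hs : FreeProb.IsFreeSemicircularFamily ψ 1
      (fun p : {q : Fin N × Fin N × ℕ+ // q.1 ≤ q.2.1} => s p.1.1 p.1.2.1 p.1.2.2)) :
    FreeProb.IsFreeSemicircularFamily (FreeProb.matrixFunctional N ψ) (1 + 1 / (N : ℝ))
        (fun k : ℕ+ => FreeProb.semicircularMatrix N s k) ∧
      (∀ (k : ℕ+) (m : ℕ), Odd m →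
        FreeProb.matrixFunctional N ψ (FreeProb.semicircularMatrix N s k ^ m) = 0) ∧
      (∀ (k : ℕ+) (n : ℕ),
        FreeProb.matrixFunctional N ψ (FreeProb.semicircularMatrix N s k ^ (2 * n)) =
          (FreeProb.numNoncrossingPairings n : ℂ) * (1 + 1 / (N : ℂ)) ^ n) := by
  have hfamily := isFreeSemicircularFamily_semicircularMatrix hψ (by omega : N ≠ 0) one_pos hs
  rw [one_mul] at hfamily
  refine ⟨hfamily, fun k m hm => ?_, fun k n => ?_⟩
  · rw [(hfamily.1 k).2, integral_odd_pow_semicircleLaw _ hm, Complex.ofReal_zero]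
  · rw [(hfamily.1 k).2, integral_even_pow_semicircleLaw (by positivity),
      numNoncrossingPairings_eq_catalan]
    push_cast
    rfl
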